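/- For a finite simple graph $\Gamma$ and vertex sets $A,B\subseteq V(\Gamma)$ (not necessarily disjoint), let $e(A,B)$ be the number of ordered pairs $(a,b)\in A\times B$ such that $\{a,b\}$ is an edge of $\Gamma$. For real numbers $c,t>0$, the graph $\Gamma$ is called $(c,t)$-sparse if $e(A,B)\le(1-c)|A||B|$ for all $A,B\subseteq V(\Gamma)$ with $|A|\ge t$ and $|B|\ge t$. **Theorem.** For every finite tree $T$ and every real $c>0$ there exists a real $C>1$, depending only on $T$ and $c$, such that the following holds. Let $t>0$ be a real number and let $\Gamma$ be a $(c,t)$-sparse graph on $n\ge1$ vertices. Then every subgraph $G\subseteq\Gamma$ with at least $Ctn$ edges contains a copy of $T$ which is induced in $\Gamma$; that is, there is an injective map $\varphi:V(T)\to V(G)$ such that $\varphi(u)\varphi(v)$ is an edge of $G$ for every edge $uv$ of $T$, and $\varphi(u)\varphi(v)$ is not an edge of $\Gamma$ for any two distinct non-adjacent vertices $u,v$ of $T$. -/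

import Mathlib

/-- A graph `Γ` is `(c, t)`-sparse if `e(A, B) ≤ (1 - c) |A| |B|` for all (not necessarily disjoint)
vertex sets `A`, `B` of size at least `t`. Here `Γ.interedges A B` is the set of ordered pairs
`(a, b) ∈ A × B` with `a`, `b` adjacent, so an edge inside `A ∩ B` is counted twice. -/
def SimpleGraph.IsSparse {V : Type*} (Γ : SimpleGraph V) (c t : ℝ) : Prop :=
  open scoped Classical in
  ∀ A B : Finset V, t ≤ (A.card : ℝ) → t ≤ (B.card : ℝ) →
    ((Γ.interedges A B).card : ℝ) ≤ (1 - c) * (A.card : ℝ) * (B.card : ℝ)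

/-- The subgraph `G` of `Γ` contains a copy of `T` which is induced in `Γ`: there is an injective map
`φ` from the vertices of `T` to those of `G` which sends edges of `T` to edges of `G`, and such that
`φ u`, `φ v` are adjacent in the big graph `Γ` exactly when `u`, `v` are adjacent in `T`. -/
def SimpleGraph.Subgraph.ContainsInducedCopy {V W : Type*} {Γ : SimpleGraph V} (G : Γ.Subgraph)
    (T : SimpleGraph W) : Prop :=
  ∃ φ : W → V, Function.Injective φ ∧ (∀ w, φ w ∈ G.verts) ∧
    (∀ u v, T.Adj u v → G.Adj (φ u) (φ v)) ∧
    (∀ u v, Γ.Adj (φ u) (φ v) ↔ T.Adj u v)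

/-! Map `T` into `G` by the stationary random walk indexed by `T`: one vertex is chosen with
probability proportional to its degree, and each further vertex is a uniform `G`-neighbour of its
already placed tree neighbour. The result does not depend on the starting vertex, so any leaf may be
treated as the last vertex placed, and every single position is distributed by degree.

Let `R` be "adjacent in `Γ` or equal". Sparsity says that, for a large set `B`, at most `t` vertices
are `R`-related to almost all of `B`. Hence, away from degrees below `D`, each step hits such a
vertex with probability at most `t / D`, and the neighbours of a given position that are unrelated
to the other positions typically keep a constant proportion (`sum_weight_bad_le`). A new leaf then
extends an induced copy with probability bounded below, so induced copies have positive total weight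
(`le_sum_weight_induced`) once `G` has enough edges to absorb the errors. -/

open scoped Classical in
/-- Every vertex `q` of a nontrivial finite tree is different from some leaf; removing the leaf
leaves a tree. -/
theorem SimpleGraph.IsTree.exists_leaf_ne {W : Type*} [Fintype W] [Nontrivial W]
    {T : SimpleGraph W} (hT : T.IsTree) (q : W) :
    ∃ (l : W) (p : {j // j ≠ l}), l ≠ q ∧ (∀ j, T.Adj l j ↔ j = p) ∧
      (T.comap (Subtype.val : {j // j ≠ l} → W)).IsTree := by
  have key : ∃ l, l ≠ q ∧ T.degree l = 1 := by
    obtain ⟨u, v, huv, hu, hv⟩ := hT.exists_ne_and_degree_eq_one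
    by_cases h : u = q
    · exact ⟨v, fun hvq => huv (h.trans hvq.symm), hv⟩
    · exact ⟨u, h, hu⟩
  obtain ⟨l, hlq, hl⟩ := key
  obtain ⟨p, hp, hpu⟩ := SimpleGraph.degree_eq_one_iff_existsUnique_adj.mp hl
  refine ⟨l, ⟨p, hp.ne'⟩, hlq, fun j => ⟨fun h => hpu j h, fun h => h ▸ hp⟩, ?_, ?_⟩
  · exact hT.connected.induce_compl_singleton_of_degree_eq_one hl
  · exact hT.isAcyclic.of_comap (Function.Embedding.subtype _)

/-! ### The unnormalized tree-indexed random walk -/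

noncomputable section

namespace TreeWalk

open Finset
open scoped Classical

variable {V : Type*} [Fintype V]

/-- The degree of a vertex, as a real number. -/
def deg (G : SimpleGraph V) (v : V) : ℝ := (G.degree v : ℝ)

theorem deg_nonneg (G : SimpleGraph V) (v : V) : 0 ≤ deg G v := Nat.cast_nonneg _

theorem card_filter_adj (G : SimpleGraph V) (v : V) :
    ((univ.filter (G.Adj v)).card : ℝ) = deg G v := by
  rw [deg, ← SimpleGraph.card_neighborFinset_eq_degree, SimpleGraph.neighborFinset_eq_filter]

/-- The kernel attached to an ordered pair of adjacent vertices of the tree. -/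
def ker (G : SimpleGraph V) (u v : V) : ℝ :=
  if G.Adj u v then (√(deg G u * deg G v))⁻¹ else 0

theorem ker_nonneg (G : SimpleGraph V) (u v : V) : 0 ≤ ker G u v := by
  unfold ker; split_ifs <;> positivity

theorem ker_comm (G : SimpleGraph V) (u v : V) : ker G u v = ker G v u := by
  simp only [ker, G.adj_comm u v, mul_comm (deg G u)]

/-- `weight` runs over ordered pairs, so each edge contributes both orientations and the square
roots combine; the degree of the new leaf cancels, leaving the transition probability from its
parent. -/
theorem deg_mul_ker (G : SimpleGraph V) (u v : V) :
    deg G v * (ker G v u * ker G u v) = if G.Adj u v then (deg G u)⁻¹ else 0 := by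
  rw [ker_comm G v u]
  unfold ker
  split_ifs with h
  · have hv : 0 < deg G v := Nat.cast_pos.2 ((G.degree_pos_iff_exists_adj v).2 ⟨u, h.symm⟩)
    rw [← mul_inv, Real.mul_self_sqrt (mul_nonneg (deg_nonneg G u) hv.le), mul_inv]
    field_simp
  · simp

/-- The weight of a map `φ : W → V`: up to normalization, the probability that the stationary
random walk on `G` indexed by the tree `T` equals `φ`. -/
def weight {W : Type*} [Fintype W] (G : SimpleGraph V) (T : SimpleGraph W) (φ : W → V) : ℝ :=
  (∏ v, deg G (φ v)) * ∏ u, ∏ v, if T.Adj u v then ker G (φ u) (φ v) else 1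

theorem weight_nonneg {W : Type*} [Fintype W] (G : SimpleGraph V) (T : SimpleGraph W)
    (φ : W → V) : 0 ≤ weight G T φ := by
  refine mul_nonneg (prod_nonneg fun v _ => deg_nonneg G _)
    (prod_nonneg fun u _ => prod_nonneg fun v _ => ?_)
  split_ifs
  · exact ker_nonneg G _ _
  · exact zero_le_one

theorem deg_ne_zero_of_weight_ne_zero {W : Type*} [Fintype W] {G : SimpleGraph V}
    {T : SimpleGraph W} {φ : W → V} (h : weight G T φ ≠ 0) (v : W) : deg G (φ v) ≠ 0 :=
  prod_ne_zero_iff.1 (left_ne_zero_of_mul h) v (mem_univ v)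

theorem adj_of_weight_ne_zero {W : Type*} [Fintype W] {G : SimpleGraph V}
    {T : SimpleGraph W} {φ : W → V} (h : weight G T φ ≠ 0) {u v : W} (huv : T.Adj u v) :
    G.Adj (φ u) (φ v) := by
  have := prod_ne_zero_iff.1 (prod_ne_zero_iff.1 (right_ne_zero_of_mul h) u (mem_univ u)) v
    (mem_univ v)
  rw [if_pos huv] at this
  by_contra hn
  exact this (if_neg hn)

/-! ### Conditioning on all vertices but a leaf -/

section Leaf

variable {W : Type*} [Fintype W] [DecidableEq W] {T : SimpleGraph W} {l : W} {p : {j // j ≠ l}}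

theorem weight_eq_of_leaf (G : SimpleGraph V) (hl : ∀ j, T.Adj l j ↔ j = p) (φ : W → V) :
    weight G T φ = weight G (T.comap (Subtype.val : {j // j ≠ l} → W)) (fun j => φ j) *
      if G.Adj (φ p) (φ l) then (deg G (φ p))⁻¹ else 0 := by
  have h1 : ∏ v, (if T.Adj l v then ker G (φ l) (φ v) else 1) = ker G (φ l) (φ p) := by
    rw [prod_eq_single (p : W)]
    · rw [if_pos ((hl _).2 rfl)]
    · intro b _ hb
      rw [if_neg (fun h => hb ((hl b).1 h))]
    · simp
  have h2 : ∏ u : {j // j ≠ l}, (if T.Adj u l then ker G (φ u) (φ l) else 1) =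
      ker G (φ p) (φ l) := by
    rw [prod_eq_single p]
    · rw [if_pos ((hl _).2 rfl).symm]
    · intro b _ hb
      rw [if_neg (fun h => hb (Subtype.ext ((hl b).1 h.symm)))]
    · simp
  have h3 : ∏ u, ∏ v, (if T.Adj u v then ker G (φ u) (φ v) else 1) =
      ker G (φ l) (φ p) * (ker G (φ p) (φ l) * ∏ u : {j // j ≠ l}, ∏ v : {j // j ≠ l},
        if T.Adj u v then ker G (φ u) (φ v) else 1) := by
    rw [Fintype.prod_eq_mul_prod_subtype_ne _ l, h1, ← h2, ← prod_mul_distrib]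
    congr 1
    refine prod_congr rfl fun u _ => ?_
    rw [Fintype.prod_eq_mul_prod_subtype_ne _ l]
  rw [← deg_mul_ker, weight, h3, Fintype.prod_eq_mul_prod_subtype_ne _ l, weight]
  simp only [SimpleGraph.comap_adj]
  ring

/-- This is the Markov property: given the rest of the walk, the leaf is uniform among the
neighbours of its parent's image. -/
theorem sum_weight_leaf (G : SimpleGraph V) (hl : ∀ j, T.Adj l j ↔ j = p)
    (H : ({j // j ≠ l} → V) → V → ℝ) :
    ∑ φ : W → V, weight G T φ * H (fun j => φ j) (φ l) =
      ∑ φ : {j // j ≠ l} → V, weight G (T.comap (Subtype.val : {j // j ≠ l} → W)) φ *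
        ((deg G (φ p))⁻¹ * ∑ x ∈ univ.filter (G.Adj (φ p)), H φ x) := by
  rw [← (Equiv.funSplitAt l V).symm.sum_comp, Fintype.sum_prod_type_right]
  refine sum_congr rfl fun φ _ => ?_
  rw [sum_filter, mul_sum, mul_sum]
  refine sum_congr rfl fun x _ => ?_
  have h1 : (Equiv.funSplitAt l V).symm (x, φ) l = x := by simp
  have h2 : (fun j : {j // j ≠ l} => (Equiv.funSplitAt l V).symm (x, φ) j) = φ := by
    funext j
    simp [j.2]
  have h3 := congrFun h2 p
  rw [weight_eq_of_leaf G hl, h1, h2, h3]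
  split_ifs <;> ring

theorem sum_weight_leaf_le (G : SimpleGraph V) (hl : ∀ j, T.Adj l j ↔ j = p)
    (F : (W → V) → ℝ) (H : ({j // j ≠ l} → V) → V → ℝ) (K : ({j // j ≠ l} → V) → ℝ)
    (hFH : ∀ φ : W → V, F φ ≤ H (fun j => φ j) (φ l))
    (hHK : ∀ φ : {j // j ≠ l} → V, 0 < deg G (φ p) →
      ∑ x ∈ univ.filter (G.Adj (φ p)), H φ x ≤ deg G (φ p) * K φ) :
    ∑ φ, weight G T φ * F φ ≤
      ∑ φ, weight G (T.comap (Subtype.val : {j // j ≠ l} → W)) φ * K φ := by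
  refine (sum_le_sum fun φ _ => mul_le_mul_of_nonneg_left (hFH φ) (weight_nonneg G T φ)).trans ?_
  rw [sum_weight_leaf G hl]
  refine sum_le_sum fun φ _ => ?_
  by_cases hw : weight G (T.comap (Subtype.val : {j // j ≠ l} → W)) φ = 0
  · simp [hw]
  have hd : 0 < deg G (φ p) :=
    lt_of_le_of_ne (deg_nonneg G _) (deg_ne_zero_of_weight_ne_zero hw p).symm
  refine mul_le_mul_of_nonneg_left ?_ (weight_nonneg G _ φ)
  rw [inv_mul_le_iff₀ hd]
  exact hHK φ hd

theorem le_sum_weight_leaf (G : SimpleGraph V) (hl : ∀ j, T.Adj l j ↔ j = p)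
    (F : (W → V) → ℝ) (H : ({j // j ≠ l} → V) → V → ℝ) (K : ({j // j ≠ l} → V) → ℝ)
    (hFH : ∀ φ : W → V, H (fun j => φ j) (φ l) ≤ F φ)
    (hHK : ∀ φ : {j // j ≠ l} → V, 0 < deg G (φ p) →
      deg G (φ p) * K φ ≤ ∑ x ∈ univ.filter (G.Adj (φ p)), H φ x) :
    ∑ φ, weight G (T.comap (Subtype.val : {j // j ≠ l} → W)) φ * K φ ≤
      ∑ φ, weight G T φ * F φ := by
  have := sum_weight_leaf_le G hl (fun φ => -F φ) (fun φ x => -H φ x) (fun φ => -K φ)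
    (fun φ => neg_le_neg (hFH φ)) (fun φ hd => by
      rw [sum_neg_distrib, mul_neg]; exact neg_le_neg (hHK φ hd))
  simpa using this

end Leaf

theorem sum_weight_of_subsingleton {W : Type*} [Fintype W] [DecidableEq W] [Subsingleton W]
    (G : SimpleGraph V) (T : SimpleGraph W) (q : W) (F : (W → V) → ℝ) :
    ∑ φ : W → V, weight G T φ * F φ = ∑ x, deg G x * F (fun _ => x) := by
  have : Unique W := ⟨⟨q⟩, fun _ => Subsingleton.elim _ _⟩
  rw [← (Equiv.funUnique W V).symm.sum_comp]
  refine sum_congr rfl fun x _ => ?_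
  have h : (Equiv.funUnique W V).symm x = fun _ => x := rfl
  have hT : ∀ u v, ¬ T.Adj u v := fun u v h => h.ne (Subsingleton.elim _ _)
  rw [h, weight]
  simp [hT]

theorem card_subtype_ne {W : Type*} [Fintype W] [DecidableEq W] (l : W) :
    Fintype.card W = Fintype.card {j // j ≠ l} + 1 := by
  rw [← Fintype.card_option, Fintype.card_congr (Equiv.optionSubtypeNe l)]

/-- Stationarity of the marginal at `q`: leaves other than `q` can be summed out until only `q`
remains. -/
theorem sum_weight_apply_le (G : SimpleGraph V) (f : V → ℝ) (m : ℕ) :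
    ∀ {W : Type*} [Fintype W] [DecidableEq W] (T : SimpleGraph W), T.IsTree → Fintype.card W = m → ∀ q : W,
      ∑ φ : W → V, weight G T φ * f (φ q) ≤ ∑ x, deg G x * f x := by
  induction m with
  | zero => intro W _ _ T _ h q; exact absurd (Fintype.card_eq_zero_iff.1 h) (fun h => h.false q)
  | succ m ih =>
    intro W _ _ T hT hm q
    rcases subsingleton_or_nontrivial W with hW | hW
    · exact (sum_weight_of_subsingleton G T q _).le
    obtain ⟨l, p, hlq, hl, hT'⟩ := hT.exists_leaf_ne q
    have hm' : Fintype.card {j // j ≠ l} = m := by have := card_subtype_ne l; omega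
    refine le_trans ?_ (ih _ hT' hm' ⟨q, hlq.symm⟩)
    refine sum_weight_leaf_le G hl _ (fun φ _ => f (φ ⟨q, hlq.symm⟩)) _ (fun φ => le_rfl) ?_
    intro φ _
    rw [sum_const, nsmul_eq_mul, card_filter_adj]

/-! ### Neighbours unrelated to the rest of the copy -/

section Avoid

variable {W : Type*} [Fintype W]

/-- The `G`-neighbours of `φ q` which are not `R`-related to any other `φ j`. -/
def avail (G : SimpleGraph V) (R : V → V → Prop) (φ : W → V) (q : W) : Finset V :=
  univ.filter fun y => G.Adj (φ q) y ∧ ∀ j, j ≠ q → ¬ R (φ j) y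

theorem mem_avail {G : SimpleGraph V} {R : V → V → Prop} {φ : W → V} {q : W} {y : V} :
    y ∈ avail G R φ q ↔ G.Adj (φ q) y ∧ ∀ j, j ≠ q → ¬ R (φ j) y := by
  simp [avail]

theorem avail_eq_filter [DecidableEq W] (G : SimpleGraph V) (R : V → V → Prop) (φ : W → V) {l : W}
    (q : {j // j ≠ l}) :
    avail G R φ q = (avail G R (fun j : {j // j ≠ l} => φ j) q).filter fun y => ¬ R (φ l) y := by
  ext y
  simp only [mem_avail, mem_filter]
  constructor
  · rintro ⟨h1, h2⟩
    exact ⟨⟨h1, fun j hj => h2 j (fun h => hj (Subtype.ext h))⟩, h2 l q.2.symm⟩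
  · rintro ⟨⟨h1, h2⟩, h3⟩
    refine ⟨h1, fun j hj => ?_⟩
    by_cases h : j = l
    · exact h ▸ h3
    · exact h2 ⟨j, h⟩ (fun h' => hj (congrArg Subtype.val h'))

/-- The set of available neighbours of `φ q` is too small. -/
def Bad (G : SimpleGraph V) (R : V → V → Prop) (D δ : ℝ) (φ : W → V) (q : W) : Prop :=
  deg G (φ q) < D ∨ ((avail G R φ q).card : ℝ) < δ ^ Fintype.card W * deg G (φ q)

/-- Non-adjacent vertices of the tree have unrelated images. -/
def Induced (T : SimpleGraph W) (R : V → V → Prop) (φ : W → V) : Prop :=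
  ∀ u v, u ≠ v → ¬ T.Adj u v → ¬ R (φ u) (φ v)

theorem induced_of_leaf [DecidableEq W] {T : SimpleGraph W} {l : W} {p : {j // j ≠ l}}
    (hl : ∀ j, T.Adj l j ↔ j = p) {G : SimpleGraph V} {R : V → V → Prop}
    (hR : ∀ x y, R x y → R y x) {φ : W → V}
    (h : Induced (T.comap (Subtype.val : {j // j ≠ l} → W)) R (fun j => φ j))
    (hx : φ l ∈ avail G R (fun j : {j // j ≠ l} => φ j) p) : Induced T R φ := by
  have key : ∀ u, u ≠ l → ¬ T.Adj l u → ¬ R (φ u) (φ l) := fun u hul hu =>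
    (mem_avail.1 hx).2 ⟨u, hul⟩ (fun h' => hu ((hl u).2 (congrArg Subtype.val h')))
  intro u v huv hT
  by_cases hu : u = l
  · subst hu
    exact fun h' => key v huv.symm hT (hR _ _ h')
  by_cases hv : v = l
  · subst hv
    exact key u huv (fun h' => hT h'.symm)
  exact h ⟨u, hu⟩ ⟨v, hv⟩ (fun h' => huv (congrArg Subtype.val h')) hT

end Avoid

/-! ### Bad positions are rare, and induced copies exist -/

/-- For every set `B` of size at least `s`, fewer than `t` vertices are `R`-related to more than a
`1 - δ` proportion of `B`. -/
def SparseRel (R : V → V → Prop) (s t δ : ℝ) : Prop :=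
  ∀ B : Finset V, s ≤ (B.card : ℝ) →
    ((univ.filter fun a => ((B.filter fun y => ¬ R a y).card : ℝ) < δ * B.card).card : ℝ) ≤ t

/-- The threshold in `Bad` drops by one factor `δ` per tree vertex, so a position can turn bad only
if the new leaf alone excludes more than a `1 - δ` proportion of the available set. -/
theorem bad_of_leaf {W : Type*} [Fintype W] [DecidableEq W] {l : W} {G : SimpleGraph V} {R : V → V → Prop}
    {D δ : ℝ} (hδ : 0 ≤ δ) {φ : W → V} {q : {j // j ≠ l}} (h : Bad G R D δ φ (q : W))
    (h' : ¬ Bad G R D δ (fun j : {j // j ≠ l} => φ j) q) :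
    (((avail G R (fun j : {j // j ≠ l} => φ j) q).filter fun y => ¬ R (φ l) y).card : ℝ) <
      δ * (avail G R (fun j : {j // j ≠ l} => φ j) q).card := by
  simp only [Bad, not_or, not_lt] at h'
  rcases h with h | h
  · exact absurd h (not_lt.2 h'.1)
  rw [avail_eq_filter, card_subtype_ne l, pow_succ'] at h
  refine h.trans_le ?_
  rw [mul_assoc]
  exact mul_le_mul_of_nonneg_left h'.2 hδ

/-- Union bound over the leaves added around `q`. Each adds an error for a parent of degree below
`D`, and an error `t / D` for landing among the at most `t` exceptional vertices of the current
available set. -/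
theorem sum_weight_bad_le (G : SimpleGraph V) (R : V → V → Prop) {s t δ D : ℝ} {M : ℕ}
    (hR : SparseRel R s t δ) (ht : 0 ≤ t) (hδ : 0 < δ) (hδ1 : δ ≤ 1) (hD : 0 < D)
    (hs : s ≤ δ ^ M * D) (m : ℕ) (hmM : m ≤ M) :
    ∀ {W : Type*} [Fintype W] [DecidableEq W] (T : SimpleGraph W), T.IsTree → Fintype.card W = m → ∀ q : W,
      ∑ φ : W → V, weight G T φ * (if Bad G R D δ φ q then 1 else 0) ≤
        m * (Fintype.card V * D + (∑ x, deg G x) * (t / D)) := by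
  have hlow : ∑ x, deg G x * (if deg G x < D then 1 else 0) ≤ Fintype.card V * D := by
    rw [← nsmul_eq_mul, ← card_univ, ← sum_const]
    refine sum_le_sum fun x _ => ?_
    split_ifs with h
    · rw [mul_one]; exact h.le
    · rw [mul_zero]; exact hD.le
  have hN : 0 ≤ (∑ x, deg G x) * (t / D) :=
    mul_nonneg (sum_nonneg fun x _ => deg_nonneg G x) (div_nonneg ht hD.le)
  induction m with
  | zero => intro W _ _ T _ h q; exact absurd (Fintype.card_eq_zero_iff.1 h) (fun h => h.false q)
  | succ m ih =>
    intro W _ _ T hT hm q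
    rcases subsingleton_or_nontrivial W with hW | hW
    · rw [sum_weight_of_subsingleton G T q]
      have h1 : ∑ x, deg G x * (if Bad G R D δ (fun _ : W => x) q then 1 else 0) ≤
          Fintype.card V * D := by
        refine le_trans (sum_le_sum fun x _ => mul_le_mul_of_nonneg_left ?_ (deg_nonneg G x)) hlow
        have : Bad G R D δ (fun _ : W => x) q → deg G x < D := by
          rintro (h | h)
          · exact h
          · exfalso
            have he : avail G R (fun _ : W => x) q = univ.filter (G.Adj x) := by
              ext y
              simp only [mem_avail, mem_filter, mem_univ, true_and, and_iff_left_iff_imp]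
              exact fun _ j hj => absurd (Subsingleton.elim j q) hj
            rw [he, card_filter_adj] at h
            have := mul_le_mul_of_nonneg_right (pow_le_one₀ hδ.le hδ1 (n := Fintype.card W))
              (deg_nonneg G x)
            linarith
        split_ifs with ha hb hb
        · exact le_rfl
        · exact absurd (this ha) hb
        · exact zero_le_one
        · exact le_rfl
      have hn : 0 ≤ (Fintype.card V : ℝ) * D := mul_nonneg (Nat.cast_nonneg _) hD.le
      have hmn : 0 ≤ (m : ℝ) * (Fintype.card V * D + (∑ x, deg G x) * (t / D)) := by positivity
      push_cast
      linarith
    obtain ⟨l, p, hlq, hl, hT'⟩ := hT.exists_leaf_ne q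
    have hm' : Fintype.card {j // j ≠ l} = m := by have := card_subtype_ne l; omega
    set q' : {j // j ≠ l} := ⟨q, hlq.symm⟩ with hq'
    set T' := T.comap (Subtype.val : {j // j ≠ l} → W) with hTdef
    have step : ∑ φ : W → V, weight G T φ * (if Bad G R D δ φ q then 1 else 0) ≤
        ∑ φ, weight G T' φ * ((if Bad G R D δ φ q' then 1 else 0) +
          (if deg G (φ p) < D then 1 else 0) + t / D) := by
      refine sum_weight_leaf_le G hl _
        (fun φ x => (if Bad G R D δ φ q' then 1 else 0) + (if deg G (φ p) < D then 1 else 0) +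
          if ¬ Bad G R D δ φ q' ∧ ¬ deg G (φ p) < D ∧
            (((avail G R φ q').filter fun y => ¬ R x y).card : ℝ) < δ * (avail G R φ q').card
          then 1 else 0)
        (fun φ => (if Bad G R D δ φ q' then 1 else 0) +
          (if deg G (φ p) < D then 1 else 0) + t / D) ?_ ?_
      · intro φ
        by_cases h : Bad G R D δ φ q
        · by_cases h1 : Bad G R D δ (fun j : {j // j ≠ l} => φ j) q'
          · simp only [h, h1, if_true, not_true_eq_false, false_and, if_false, add_zero]
            split_ifs <;> norm_num
          · have h2 := bad_of_leaf hδ.le (q := q') h h1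
            simp only [h, h1, h2, if_true, if_false, not_false_eq_true, true_and, and_true]
            split_ifs <;> norm_num
        · rw [if_neg h]
          positivity
      · intro φ hd
        rw [sum_add_distrib, sum_const, nsmul_eq_mul, card_filter_adj, mul_add _ _ (t / D)]
        refine add_le_add le_rfl ?_
        rw [sum_boole]
        by_cases h : ¬ Bad G R D δ φ q' ∧ ¬ deg G (φ p) < D
        -- As `q'` is not yet bad, its available set is large enough for `SparseRel`; this is the
        -- role of `hs`.
        · have hcard : s ≤ ((avail G R φ q').card : ℝ) := by
            have h1 := h.1
            simp only [Bad, not_or, not_lt] at h1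
            refine hs.trans (le_trans ?_ h1.2)
            refine mul_le_mul (pow_le_pow_of_le_one hδ.le hδ1 (by omega)) h1.1 hD.le
              (pow_nonneg hδ.le _)
          refine le_trans ?_ ((hR _ hcard).trans ?_)
          · refine Nat.cast_le.2 (card_le_card fun x hx => ?_)
            simp only [mem_filter, mem_univ, true_and] at hx ⊢
            exact hx.2.2.2
          · have := not_lt.1 h.2
            rw [mul_div_assoc', le_div_iff₀ hD, mul_comm]
            exact mul_le_mul_of_nonneg_right this ht
        · have : ∀ x, ¬ (¬ Bad G R D δ φ q' ∧ ¬ deg G (φ p) < D ∧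
            (((avail G R φ q').filter fun y => ¬ R x y).card : ℝ) < δ * (avail G R φ q').card) :=
            fun x hx => h ⟨hx.1, hx.2.1⟩
          simp only [this, filter_false, card_empty, Nat.cast_zero]
          positivity
    refine step.trans ?_
    simp only [mul_add, sum_add_distrib, ← sum_mul]
    have h1 := ih (by omega) T' hT' hm' q'
    have h2 := (sum_weight_apply_le G (fun x => if deg G x < D then 1 else 0) m T' hT' hm' p).trans
      hlow
    have h3 := sum_weight_apply_le G (fun _ => 1) m T' hT' hm' p
    simp only [mul_one] at h3
    have h4 := mul_le_mul_of_nonneg_right h3 (div_nonneg ht hD.le)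
    push_cast
    linarith

/-- If the smaller copy is induced and the leaf's parent is not bad, at least a `δ ^ M` proportion
of the choices for the leaf keeps it induced. Each leaf thus costs a factor `δ ^ M` and the weight
of the bad maps. -/
theorem le_sum_weight_induced (G : SimpleGraph V) (R : V → V → Prop) {s t δ D : ℝ} {M : ℕ}
    (hRs : ∀ x y, R x y → R y x)
    (hR : SparseRel R s t δ) (ht : 0 ≤ t) (hδ : 0 < δ) (hδ1 : δ ≤ 1) (hD : 0 < D)
    (hs : s ≤ δ ^ M * D) (m : ℕ) (hmM : m ≤ M) :
    ∀ {W : Type*} [Fintype W] [DecidableEq W] (T : SimpleGraph W), T.IsTree → Fintype.card W = m →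
      (δ ^ M) ^ m * (∑ x, deg G x) -
          m * (M * (Fintype.card V * D + (∑ x, deg G x) * (t / D))) ≤
        ∑ φ : W → V, weight G T φ * (if Induced T R φ then 1 else 0) := by
  have hγ : 0 < δ ^ M := pow_pos hδ M
  have hγ1 : δ ^ M ≤ 1 := pow_le_one₀ hδ.le hδ1
  have hN : 0 ≤ ∑ x, deg G x := sum_nonneg fun x _ => deg_nonneg G x
  have hE : 0 ≤ Fintype.card V * D + (∑ x, deg G x) * (t / D) := by positivity
  induction m with
  | zero =>
    intro W _ _ T hT h
    obtain ⟨q⟩ := hT.connected.nonempty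
    exact absurd (Fintype.card_eq_zero_iff.1 h) (fun h => h.false q)
  | succ m ih =>
    intro W _ _ T hT hm
    obtain ⟨q⟩ := hT.connected.nonempty
    rcases subsingleton_or_nontrivial W with hW | hW
    · rw [sum_weight_of_subsingleton G T q]
      have : ∀ x, Induced T R (fun _ : W => x) :=
        fun x u v huv => absurd (Subsingleton.elim u v) huv
      simp only [this, if_true, mul_one]
      have h1 := mul_le_mul_of_nonneg_right (pow_le_one₀ hγ.le hγ1 (n := m + 1)) hN
      have h2 : 0 ≤ ((m + 1 : ℕ) : ℝ) *
        (M * (Fintype.card V * D + (∑ x, deg G x) * (t / D))) := by positivity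
      linarith
    obtain ⟨l, p, -, hl, hT'⟩ := hT.exists_leaf_ne q
    have hm' : Fintype.card {j // j ≠ l} = m := by have := card_subtype_ne l; omega
    set T' := T.comap (Subtype.val : {j // j ≠ l} → W) with hTdef
    have step : ∑ φ, weight G T' φ * (δ ^ M *
        ((if Induced T' R φ then 1 else 0) - (if Bad G R D δ φ p then 1 else 0))) ≤
        ∑ φ : W → V, weight G T φ * (if Induced T R φ then 1 else 0) := by
      refine le_sum_weight_leaf G hl _
        (fun φ x => if Induced T' R φ ∧ x ∈ avail G R φ p then 1 else 0) _ ?_ ?_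
      · intro φ
        split_ifs with h1 h2 h2
        · exact le_rfl
        · exact absurd (induced_of_leaf hl hRs h1.1 h1.2) h2
        · exact zero_le_one
        · exact le_rfl
      · intro φ hd
        by_cases h1 : Induced T' R φ
        · by_cases h2 : Bad G R D δ φ p
          · simp only [h1, h2, if_true, sub_self, mul_zero]
            positivity
          · simp only [h1, h2, if_true, if_false, sub_zero, mul_one, true_and]
            rw [sum_boole]
            have h3 := h2
            simp only [Bad, not_or, not_lt] at h3
            have h4 : (univ.filter (G.Adj (φ p))).filter (fun x => x ∈ avail G R φ p) =
                avail G R φ p := by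
              ext x
              simp only [mem_filter, mem_univ, true_and, and_iff_right_iff_imp]
              exact fun hx => (mem_avail.1 hx).1
            rw [h4, mul_comm]
            refine le_trans ?_ h3.2
            exact mul_le_mul_of_nonneg_right
              (pow_le_pow_of_le_one hδ.le hδ1 (by omega)) hd.le
        · simp only [h1, if_false, false_and, sum_const_zero]
          refine mul_nonpos_of_nonneg_of_nonpos hd.le
            (mul_nonpos_of_nonneg_of_nonpos hγ.le ?_)
          split_ifs <;> norm_num
    refine le_trans ?_ step
    have h1 := ih (by omega) T' hT' hm'
    have h2 := sum_weight_bad_le G R hR ht hδ hδ1 hD hs m (by omega) T' hT' hm' p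
    have h3 : ∑ φ, weight G T' φ * (δ ^ M *
        ((if Induced T' R φ then 1 else 0) - (if Bad G R D δ φ p then 1 else 0))) =
        δ ^ M * (∑ φ, weight G T' φ * (if Induced T' R φ then 1 else 0) -
          ∑ φ, weight G T' φ * (if Bad G R D δ φ p then 1 else 0)) := by
      rw [← sum_sub_distrib, mul_sum]
      refine sum_congr rfl fun φ _ => ?_
      ring
    rw [h3]
    set E := Fintype.card V * D + (∑ x, deg G x) * (t / D) with hEdef
    set N := ∑ x, deg G x with hNdef
    have hmM' : (m : ℝ) * E ≤ M * E :=
      mul_le_mul_of_nonneg_right (Nat.cast_le.2 (by omega)) hE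
    have hk : 0 ≤ ((m : ℝ) + 1) * (M * E) := by positivity
    have h4 : δ ^ M * ((δ ^ M) ^ m * N - (m + 1) * (M * E)) ≤ δ ^ M *
        (∑ φ, weight G T' φ * (if Induced T' R φ then 1 else 0) -
          ∑ φ, weight G T' φ * (if Bad G R D δ φ p then 1 else 0)) :=
      mul_le_mul_of_nonneg_left (by linarith) hγ.le
    have h5 := mul_le_mul_of_nonneg_right hγ1 hk
    refine le_trans ?_ h4
    push_cast
    rw [pow_succ']
    linarith

/-- A graph with sufficiently many edges contains a copy of the tree `T` in which non-adjacent
vertices of `T` are not related by `R`. -/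
theorem exists_induced_of_sparseRel {W : Type*} [Fintype W] [DecidableEq W] {T : SimpleGraph W} (hT : T.IsTree)
    (G : SimpleGraph V) (R : V → V → Prop) {s t δ D : ℝ}
    (hRs : ∀ x y, R x y → R y x)
    (hR : SparseRel R s t δ) (ht : 0 ≤ t) (hδ : 0 < δ) (hδ1 : δ ≤ 1) (hD : 0 < D)
    (hs : s ≤ δ ^ Fintype.card W * D)
    (hG : Fintype.card W * (Fintype.card W * (Fintype.card V * D + (∑ x, deg G x) * (t / D))) <
      (δ ^ Fintype.card W) ^ Fintype.card W * (∑ x, deg G x)) :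
    ∃ φ : W → V, Induced T R φ ∧ (∀ v, 0 < G.degree (φ v)) ∧
      ∀ u v, T.Adj u v → G.Adj (φ u) (φ v) := by
  have h := le_sum_weight_induced G R hRs hR ht hδ hδ1 hD hs _ le_rfl T hT rfl
  obtain ⟨φ, -, hφ⟩ := exists_ne_zero_of_sum_ne_zero (ne_of_gt (lt_of_lt_of_le (sub_pos.2 hG) h))
  have hw := left_ne_zero_of_mul hφ
  refine ⟨φ, ?_, fun v => ?_, fun u v huv => adj_of_weight_ne_zero hw huv⟩
  · by_contra hn
    exact right_ne_zero_of_mul hφ (if_neg hn)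
  · exact Nat.pos_of_ne_zero fun h0 => deg_ne_zero_of_weight_ne_zero hw v (by simp [deg, h0])

/-! ### From sparsity of the host graph to the theorem -/

/-- More than `t` exceptional vertices would form a set too dense towards `B`. Half of `c` is given
up to allow for equality in `R`. -/
theorem sparseRel_of_isSparse {Γ : SimpleGraph V} {R : V → V → Prop} {c t : ℝ}
    (hR : ∀ a b, R a b → Γ.Adj a b ∨ a = b) (hc : 0 < c) (hc1 : c ≤ 1)
    (ht : 1 ≤ t) (h : Γ.IsSparse c t) :
    SparseRel R (2 * t / c) t (c / 2) := by
  intro B hB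
  set A : Finset V := univ.filter fun a =>
    ((B.filter fun y => ¬ R a y).card : ℝ) < c / 2 * B.card
  by_contra hle
  have hlt : t < (A.card : ℝ) := not_le.1 hle
  have hcB : 2 * t ≤ B.card * c := (div_le_iff₀ hc).1 hB
  have hBt : t ≤ (B.card : ℝ) := by
    have : (B.card : ℝ) * c ≤ B.card * 1 := mul_le_mul_of_nonneg_left hc1 (Nat.cast_nonneg _)
    linarith
  have h1 := h A B hlt.le hBt
  have h2 : ((Γ.interedges A B).card : ℝ) =
      ∑ a ∈ A, ((B.filter fun y => Γ.Adj a y).card : ℝ) := by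
    rw [SimpleGraph.interedges_def, card_filter, sum_product]
    push_cast
    refine sum_congr rfl fun a _ => ?_
    rw [card_filter]
    push_cast
    rfl
  have h3 : ∀ a ∈ A, (1 - c) * B.card < ((B.filter fun y => Γ.Adj a y).card : ℝ) := by
    intro a ha
    have ha' := (mem_filter.1 ha).2
    -- The `1` accounts for `y = a`; it is absorbed below since `1 ≤ t ≤ c * B.card / 2`.
    have h4 : B.card ≤ (B.filter fun y => Γ.Adj a y).card + 1 +
        (B.filter fun y => ¬ R a y).card := by
      calc B.card ≤ ((B.filter fun y => Γ.Adj a y) ∪ {a} ∪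
            B.filter fun y => ¬ R a y).card := by
            refine card_le_card fun y hy => ?_
            simp only [mem_union, mem_filter, mem_singleton, hy, true_and]
            by_cases hay : Γ.Adj a y
            · exact Or.inl (Or.inl hay)
            · by_cases he : a = y
              · exact Or.inl (Or.inr he.symm)
              · exact Or.inr fun h' => (hR a y h').elim hay he
        _ ≤ _ := (card_union_le _ _).trans
            (Nat.add_le_add_right ((card_union_le _ _).trans (by simp)) _)
    have h5 : (B.card : ℝ) ≤ (B.filter fun y => Γ.Adj a y).card + 1 +
        (B.filter fun y => ¬ R a y).card := by exact_mod_cast h4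
    linarith
  have hne : A.Nonempty := by
    rw [← card_pos]
    have : (0 : ℝ) < A.card := by linarith
    exact_mod_cast this
  have h6 := sum_lt_sum_of_nonempty hne h3
  rw [sum_const, nsmul_eq_mul, ← h2] at h6
  have h7 : (A.card : ℝ) * ((1 - c) * B.card) = (1 - c) * A.card * B.card := by ring
  linarith

end TreeWalk

end

theorem SimpleGraph.IsSparse.mono {V : Type*} {Γ : SimpleGraph V} {c c' t : ℝ}
    (h : Γ.IsSparse c t) (hc : c' ≤ c) : Γ.IsSparse c' t := by
  intro A B hA hB
  refine (h A B hA hB).trans ?_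
  gcongr

theorem SimpleGraph.IsSparse.not_adj_of_le_one {V : Type*} {Γ : SimpleGraph V} {c t : ℝ}
    (h : Γ.IsSparse c t) (hc : 0 < c) (ht : t ≤ 1) (a b : V) : ¬ Γ.Adj a b := by
  intro hab
  have h1 := h {a} {b} (by simpa using ht) (by simpa using ht)
  rw [SimpleGraph.interedges_def] at h1
  simp [Finset.filter_singleton, hab] at h1
  linarith

open scoped Classical in
theorem SimpleGraph.Subgraph.sum_deg_spanningCoe {V : Type*} [Fintype V] {Γ : SimpleGraph V}
    (G : Γ.Subgraph) : ∑ x, TreeWalk.deg G.spanningCoe x = 2 * (G.edgeSet.ncard : ℝ) := by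
  have h := G.spanningCoe.sum_degrees_eq_twice_card_edges
  have h2 : G.spanningCoe.edgeFinset.card = G.edgeSet.ncard := by
    rw [← SimpleGraph.Subgraph.edgeSet_spanningCoe, ← SimpleGraph.coe_edgeFinset,
      Set.ncard_coe_finset]
  rw [h2] at h
  unfold TreeWalk.deg
  exact_mod_cast h

theorem theorem1p6 {W : Type*} [Finite W] (T : SimpleGraph W) (hT : T.IsTree)
    (c : ℝ) (hc : 0 < c) :
    ∃ C : ℝ, 1 < C ∧
      ∀ (V : Type*) [Fintype V] [Nonempty V] (Γ : SimpleGraph V) (t : ℝ), 0 < t →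
        Γ.IsSparse c t →
          ∀ G : Γ.Subgraph, C * t * (Fintype.card V : ℝ) ≤ (G.edgeSet.ncard : ℝ) →
            G.ContainsInducedCopy T := by
  classical
  have := Fintype.ofFinite W
  -- Lowering `c` preserves sparsity and makes `δ = b / 2` at most `1`.
  set b : ℝ := min c 1 with hb
  have hb0 : 0 < b := lt_min hc one_pos
  have hb1 : b ≤ 1 := min_le_right _ _
  set m := Fintype.card W with hm
  set γ : ℝ := (b / 2) ^ m with hγ
  have hγ0 : 0 < γ := by positivity
  -- With `D = K * t`, the second term makes available sets reach size `2 * t / b`, and the third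
  -- makes the error smaller than the main term.
  set K : ℝ := 1 + 2 / b / γ + 2 * (m * m) / γ ^ m with hK
  have hx : 0 ≤ 2 / b / γ := by positivity
  have hy : 0 ≤ 2 * ((m : ℝ) * m) / γ ^ m := by positivity
  have hbγ : 0 < 2 / b / γ := by positivity
  have hK1 : 1 < K := by linarith
  refine ⟨K ^ 2, by nlinarith, ?_⟩
  intro V _ _ Γ t ht hΓ G hG
  have hn : 0 < (Fintype.card V : ℝ) := Nat.cast_pos.2 Fintype.card_pos
  have he : 0 < (G.edgeSet.ncard : ℝ) := lt_of_lt_of_le (by positivity) hG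
  -- For `t < 1`, sparsity applied to singletons rules out every edge of `Γ`.
  have ht1 : 1 ≤ t := by
    by_contra! h
    have h0 : G.edgeSet = ∅ := by
      ext e
      induction e with
      | _ u v => simpa using fun h' : G.Adj u v =>
          hΓ.not_adj_of_le_one hc h.le u v h'.adj_sub
    rw [h0] at he
    simp at he
  have hR := TreeWalk.sparseRel_of_isSparse (fun a b (h : Γ.Adj a b ∨ a = b) => h) hb0 hb1 ht1 (hΓ.mono (min_le_left c 1))
  have hN := G.sum_deg_spanningCoe
  set N := ∑ x, TreeWalk.deg G.spanningCoe x with hNdef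
  have hN0 : 0 < N := by linarith
  obtain ⟨φ, hI, hdeg, hadj⟩ := TreeWalk.exists_induced_of_sparseRel hT G.spanningCoe
    (fun a b => Γ.Adj a b ∨ a = b) (D := K * t)
    (fun x y h => h.imp (fun h => h.symm) (fun h => h.symm)) hR ht.le (by positivity)
    (by linarith) (by positivity)
    (by
      have h1 : 2 / b / γ * γ * t ≤ K * γ * t := by
        gcongr
        linarith
      rw [div_mul_cancel₀ _ hγ0.ne'] at h1
      calc 2 * t / b = 2 / b * t := by ring
        _ ≤ K * γ * t := h1
        _ = γ * (K * t) := by ring)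
    (by
      have h1 : t / (K * t) = 1 / K := by field_simp
      -- Here `C = K ^ 2` is used: one factor `K` pays for `D`, the other makes the low-degree error
      -- a `1 / K` fraction of the total weight.
      have h2 : Fintype.card V * (K * t) ≤ N / 2 * (1 / K) := by
        rw [mul_one_div, le_div_iff₀ (by linarith)]
        nlinarith
      have h3 : 2 * ((m : ℝ) * m) < K * γ ^ m := by
        rw [← div_lt_iff₀ (by positivity)]
        linarith
      rw [← hNdef, h1]
      have h4 : (m : ℝ) * (m * (Fintype.card V * (K * t) + N * (1 / K))) ≤
          m * (m * (2 * (N * (1 / K)))) := by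
        have : 0 < N * (1 / K) := by positivity
        gcongr
        linarith
      refine lt_of_le_of_lt h4 ?_
      have h5 : (m : ℝ) * (m * (2 * (N * (1 / K)))) = 2 * (m * m) * N / K := by ring
      rw [h5, div_lt_iff₀ (by linarith)]
      nlinarith)
  refine ⟨φ, ?_, ?_, fun u v h => hadj u v h, ?_⟩
  · intro u v huv
    by_contra hne
    by_cases h : T.Adj u v
    · exact (hadj u v h).ne huv
    · exact hI u v hne h (Or.inr huv)
  · intro w
    -- Positive degree is needed because a one-vertex `T` has no edge to place its image in
    -- `G.verts`.
    obtain ⟨x, hx⟩ := (G.spanningCoe.degree_pos_iff_exists_adj _).1 (hdeg w)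
    exact G.edge_vert hx
  · intro u v
    refine ⟨fun h => ?_, fun h => (hadj u v h).adj_sub⟩
    by_contra hn
    by_cases huv : u = v
    · exact h.ne (congrArg φ huv)
    · exact hI u v huv hn (Or.inl h)
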